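/- Let $A,B$ be finite alphabets, let $k\ge 1$, and let $\{(X_n,Y_n)\,;\,n\ge -k+1\}$ be a homogeneous Markov chain on $A\times B$ of order no larger than $k$, with an arbitrary distribution of the initial block $(X_{-k+1}^0,Y_{-k+1}^0)$. Assume that the chain is irreducible and aperiodic. This means the following for the first-order chain of blocks $(X_{n-k+1}^n,Y_{n-k+1}^n)$ on $(A\times B)^k$: every block leads, with positive probability in some number of steps, to every recurrent block, and every recurrent block has period $1$. (Transient blocks are thus allowed; if there are none, this is irreducibility and aperiodicity in the usual sense.) Let $\{(\bar X_n,\bar Y_n)\,;\,n\in\mathbb Z\}$ be the two-sided stationary chain with the same transition probabilities. Here $V_i^j=(V_i,\dots,V_j)$ (empty if $j<i$), $H$ denotes entropy with natural logarithms, $H(V|W)=H(V,W)-H(W)$, $I(V;W|Z)=H(V|Z)+H(W|Z)-H(V,W|Z)$, and $$I(X_1^n\to Y_1^n)=H(Y_1^n)-\sum_{i=1}^n H(Y_i\mid Y_1^{i-1},X_1^i).$$ (i) The entropy rate $H(\mathbf Y)=\lim_{n\to\infty}\frac1n H(Y_1^n)$ of $\mathbf Y=\{Y_n\}$ exists, and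 it equals $\lim_{n\to\infty}\frac1n H(\bar Y_1^n)$. (ii) The directed information rate $I(\mathbf X\to\mathbf Y)=\lim_{n\to\infty}\frac1n I(X_1^n\to Y_1^n)$ exists, and $$I(\mathbf X\to\mathbf Y)=H(\mathbf Y)-H(\bar Y_0\mid \bar X_{-k}^0,\bar Y_{-k}^{-1}).$$ (iii) If $\{Y_n\,;\,n\ge -k+1\}$ is also a Markov chain of order no larger than $k$ (that is, for every $n\ge 1$, $Y_n$ is conditionally independent of $Y_{-k+1}^{n-1}$ given $Y_{n-k}^{n-1}$), then $$I(\mathbf X\to\mathbf Y)=I(\bar Y_0;\bar X_{-k}^0\mid \bar Y_{-k}^{-1}).$$ -/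

import Mathlib

open MeasureTheory Filter Topology

namespace DirectedInfo

noncomputable section

section Entropy

variable {Ω S T U : Type*} [MeasurableSpace Ω]

/-- Entropy (natural logarithm) of a random variable with values in a finite set,
`H(V) = -∑ P(V = v) log P(V = v)`. -/
def entropy [Fintype S] (μ : Measure Ω) (V : Ω → S) : ℝ :=
  ∑ v, Real.negMulLog (μ.real {ω | V ω = v})

/-- Conditional entropy `H(V | W) = H(V, W) - H(W)`. -/
def condEntropy [Fintype S] [Fintype T] (μ : Measure Ω) (V : Ω → S) (W : Ω → T) : ℝ :=
  entropy μ (fun ω => (V ω, W ω)) - entropy μ W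

/-- Conditional mutual information `I(V; W | R) = H(V | R) + H(W | R) - H(V, W | R)`. -/
def condMutualInfo [Fintype S] [Fintype T] [Fintype U] (μ : Measure Ω)
    (V : Ω → S) (W : Ω → T) (R : Ω → U) : ℝ :=
  condEntropy μ V R + condEntropy μ W R - condEntropy μ (fun ω => (V ω, W ω)) R

end Entropy

section Processes

variable {Ω S A B : Type*}

/-- The block of `m` consecutive values `(Z_i, Z_{i+1}, …, Z_{i+m-1})`. -/
def block (Z : ℤ → Ω → S) (i : ℤ) (m : ℕ) (ω : Ω) : Fin m → S :=
  fun j => Z (i + (j : ℕ)) ω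

variable [MeasurableSpace Ω]

/-- Directed information
`I(X_1^n → Y_1^n) = H(Y_1^n) - ∑_{i=1}^n H(Y_i | Y_1^{i-1}, X_1^i)`
(the summation index is shifted by one: the term with index `i` is that of `Y_{i+1}`). -/
def directedInfo [Fintype A] [Fintype B] (μ : Measure Ω) (X : ℤ → Ω → A) (Y : ℤ → Ω → B)
    (n : ℕ) : ℝ :=
  entropy μ (block Y 1 n) -
    ∑ i ∈ Finset.range n,
      condEntropy μ (Y ((i : ℤ) + 1)) (fun ω => (block Y 1 i ω, block X 1 (i + 1) ω))

/-- The entropy rate `lim (1/n) H(Y_1^n)` exists and equals `h`. -/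
def HasEntropyRate [Fintype B] (μ : Measure Ω) (Y : ℤ → Ω → B) (h : ℝ) : Prop :=
  Tendsto (fun n : ℕ => (1 / (n : ℝ)) * entropy μ (block Y 1 n)) atTop (𝓝 h)

/-- The directed information rate `lim (1/n) I(X_1^n → Y_1^n)` exists and equals `r`. -/
def HasDirectedInfoRate [Fintype A] [Fintype B] (μ : Measure Ω)
    (X : ℤ → Ω → A) (Y : ℤ → Ω → B) (r : ℝ) : Prop :=
  Tendsto (fun n : ℕ => (1 / (n : ℝ)) * directedInfo μ X Y n) atTop (𝓝 r)

/-- `{Z_n ; n ≥ 1 - k}` is a homogeneous Markov chain of memory length `k` with transition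
probabilities `Q`: for all `n ≥ 0`, given `(Z_{1-k}, …, Z_n) = w`, the next value `Z_{n+1}` is
distributed according to `Q`, evaluated at the last `k` symbols of `w`. The law of the
initial block `(Z_{1-k}, …, Z_0)` is arbitrary. -/
def IsMarkovChain (μ : Measure Ω) (Z : ℤ → Ω → S) (k : ℕ) (Q : (Fin k → S) → S → ℝ) : Prop :=
  ∀ (n : ℕ) (w : Fin (n + k) → S) (z : S),
    μ.real {ω | block Z (1 - (k : ℤ)) (n + k) ω = w ∧ Z ((n : ℤ) + 1) ω = z} =
      μ.real {ω | block Z (1 - (k : ℤ)) (n + k) ω = w} * Q (fun j => w (Fin.natAdd n j)) z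

/-- `{Z_n ; n ≥ 1 - k}` has the Markov property of order (no larger than) `k`: for all `n ≥ 0`,
`Z_{n+1}` is conditionally independent of `(Z_{1-k}, …, Z_n)` given `(Z_{n+1-k}, …, Z_n)`,
written without division as
`P(Z_{1-k}^n = w, Z_{n+1} = z) P(Z_{n+1-k}^n = w') = P(Z_{1-k}^n = w) P(Z_{n+1-k}^n = w', Z_{n+1} = z)`
with `w'` the last `k` symbols of `w`. -/
def IsMarkovOfOrder (μ : Measure Ω) (Z : ℤ → Ω → S) (k : ℕ) : Prop :=
  ∀ (n : ℕ) (w : Fin (n + k) → S) (z : S),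
    μ.real {ω | block Z (1 - (k : ℤ)) (n + k) ω = w ∧ Z ((n : ℤ) + 1) ω = z} *
        μ.real {ω | block Z ((n : ℤ) + 1 - k) k ω = fun j => w (Fin.natAdd n j)} =
      μ.real {ω | block Z (1 - (k : ℤ)) (n + k) ω = w} *
        μ.real {ω | (block Z ((n : ℤ) + 1 - k) k ω = fun j => w (Fin.natAdd n j)) ∧
          Z ((n : ℤ) + 1) ω = z}

/-- The two-sided process `{Z_n ; n ∈ ℤ}` is stationary. -/
def IsStationary (μ : Measure Ω) (Z : ℤ → Ω → S) : Prop :=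
  ∀ (i j : ℤ) (m : ℕ) (w : Fin m → S),
    μ.real {ω | block Z i m ω = w} = μ.real {ω | block Z j m ω = w}

end Processes

section Transitions

variable {S : Type*} {k : ℕ}

/-- The block obtained from `s` by dropping its first symbol and appending `z`. -/
def nextBlock (s : Fin k → S) (z : S) : Fin k → S :=
  fun j => if h : (j : ℕ) + 1 < k then s ⟨(j : ℕ) + 1, h⟩ else z

/-- The first-order chain of blocks `(Z_{n-k+1}, …, Z_n)` of length `k` goes from `s` to `t` with
positive probability in exactly `n` steps. -/
def LeadsIn (Q : (Fin k → S) → S → ℝ) : ℕ → (Fin k → S) → (Fin k → S) → Prop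
  | 0, s, t => s = t
  | n + 1, s, t => ∃ z, 0 < Q s z ∧ LeadsIn Q n (nextBlock s z) t

/-- The block `s` leads to the block `t` (in some number of steps, possibly zero). -/
def Leads (Q : (Fin k → S) → S → ℝ) (s t : Fin k → S) : Prop :=
  ∃ n, LeadsIn Q n s t

/-- A block is recurrent if it is reached back from every block that it leads to. -/
def IsRecurrent (Q : (Fin k → S) → S → ℝ) (s : Fin k → S) : Prop :=
  ∀ t, Leads Q s t → Leads Q t s

/-- Irreducibility: every block leads to every recurrent block. If no block is transient,
this says that all blocks communicate. Transient blocks have to be allowed because, for instance, for a chain of order `1` some of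
whose transition probabilities vanish, not every block of length `k ≥ 2` can be reached. -/
def IsIrreducible (Q : (Fin k → S) → S → ℝ) : Prop :=
  ∀ s t, IsRecurrent Q t → Leads Q s t

/-- Aperiodicity: every recurrent block has period one. -/
def IsAperiodic (Q : (Fin k → S) → S → ℝ) : Prop :=
  ∀ s, IsRecurrent Q s → ∀ d : ℕ, (∀ n : ℕ, 1 ≤ n → LeadsIn Q n s s → d ∣ n) → d = 1

end Transitions

end

end DirectedInfo

open DirectedInfo

/-! The output process alone need not be Markov, so its entropy rate is handled through the pair
chain. Fix a time `m`. Given the pair block ending at `m`, the law of the next `n` outputs depends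
only on `Q` (`IsMarkovChain.measureReal_block_emission`). Hence the entropy of `Y` over times `1` to
`m + n` differs from the average of `emissionEntropy Q n` over the law of that block by an amount
bounded independently of `n` (`IsMarkovChain.exists_entropy_block_bound`). By Doeblin's contraction
(`exists_avg_contraction`) the law of the block at time `m` tends to the stationary one
(`IsMarkovChain.tendsto_law`). Since `emissionEntropy Q n` is at most `n * log |B|`, a large fixed
`m` leaves an error of the form `C + ε n` between the given chain and the stationary one. So both
have the same entropy rate, which exists in the stationary case by Fekete's subadditive lemma.

For the directed information, once `k` symbols have been seen the Markov property makes each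
causally conditioned entropy the average, over the law of the current block, of a fixed function of
the block. These terms converge with the law (`IsMarkovChain.tendsto_condEntropy`), hence so do
their Cesàro means.

If `Y` is Markov, the increments of its joint entropy are conditional entropies given `k` symbols.
They are continuous functions of the law of the block and the next pair, so they converge to the
stationary value, and Cesàro identifies the entropy rate (`IsMarkovOfOrder.hasEntropyRate`). Part
(iii) is then the definition of conditional mutual information. -/

namespace DirectedInfo

/-! ### Entropy of finite-valued random variables -/

section EntropyLemmas

variable {Ω S T U R : Type*} [MeasurableSpace Ω] {μ : Measure Ω}

/-- Decomposition of the measure of an arbitrary set along the fibres of a measurable map. -/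
lemma measureReal_eq_sum_fiber [IsFiniteMeasure μ] [Fintype T] [MeasurableSpace T]
    [MeasurableSingletonClass T] {W : Ω → T} (hW : Measurable W) (E : Set Ω) :
    μ.real E = ∑ w, μ.real {ω | ω ∈ E ∧ W ω = w} := by
  -- Restricting `μ` to `E` leaves only the fibres of `W` to be measurable; `E` itself may be any
  -- set.
  have h := sum_measureReal_preimage_singleton (μ := μ.restrict E) (Finset.univ : Finset T)
    (f := W) (fun y _ => hW (measurableSet_singleton y))
  simp only [Finset.coe_univ, Set.preimage_univ, measureReal_restrict_apply_univ] at h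
  rw [← h]
  refine Finset.sum_congr rfl fun w _ => ?_
  rw [measureReal_restrict_apply (hW (measurableSet_singleton w))]
  congr 1
  ext ω
  simp [and_comm]

lemma sum_measureReal_eq_one [IsProbabilityMeasure μ] [Fintype T] [MeasurableSpace T]
    [MeasurableSingletonClass T] {W : Ω → T} (hW : Measurable W) :
    ∑ w, μ.real {ω | W ω = w} = 1 := by
  have h := measureReal_eq_sum_fiber (μ := μ) hW Set.univ
  simpa using h.symm

lemma sum_measureReal_prod_right [IsFiniteMeasure μ] [Fintype T] [MeasurableSpace T]
    [MeasurableSingletonClass T] {W : Ω → T} (hW : Measurable W) (V : Ω → S) (v : S) :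
    ∑ w, μ.real {ω | (V ω, W ω) = (v, w)} = μ.real {ω | V ω = v} := by
  rw [measureReal_eq_sum_fiber hW]
  simp [Prod.ext_iff]

lemma sum_measureReal_prod_left [IsFiniteMeasure μ] [Fintype S] [MeasurableSpace S]
    [MeasurableSingletonClass S] {V : Ω → S} (hV : Measurable V) (W : Ω → T) (w : T) :
    ∑ v, μ.real {ω | (V ω, W ω) = (v, w)} = μ.real {ω | W ω = w} := by
  rw [measureReal_eq_sum_fiber hV]
  simp [Prod.ext_iff, and_comm]

/-- Two variables which generate the same partition have the same entropy. -/
lemma entropy_congr_of_ker [Fintype S] [Fintype T] {V : Ω → S} {W : Ω → T}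
    (h : ∀ ω ω', V ω = V ω' ↔ W ω = W ω') : entropy μ V = entropy μ W := by
  have key : ∀ ω, μ.real {ω' | V ω' = V ω} = μ.real {ω' | W ω' = W ω} := fun ω => by
    simp only [h]
  -- A value that is never attained contributes `negMulLog 0 = 0`, so the sums can be matched along
  -- attained values.
  have ne1 : ∀ v, Real.negMulLog (μ.real {ω | V ω = v}) ≠ 0 → ∃ ω, V ω = v := by
    intro v hv
    by_contra! hc
    simp [hc] at hv
  have ne2 : ∀ v, Real.negMulLog (μ.real {ω | W ω = v}) ≠ 0 → ∃ ω, W ω = v := by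
    intro v hv
    by_contra! hc
    simp [hc] at hv
  unfold entropy
  refine Finset.sum_bij_ne_zero (fun v _ hv => W (ne1 v hv).choose) (fun _ _ _ => by simp)
    ?_ ?_ ?_
  · intro v _ hv v' _ hv' e
    rw [← h, (ne1 v hv).choose_spec, (ne1 v' hv').choose_spec] at e
    exact e
  · intro w _ hw
    obtain ⟨ω, rfl⟩ := ne2 w hw
    have hv : Real.negMulLog (μ.real {ω' | V ω' = V ω}) ≠ 0 := by rwa [key]
    exact ⟨V ω, by simp, hv, (h _ _).1 (ne1 _ hv).choose_spec⟩
  · intro v _ hv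
    rw [← key, (ne1 v hv).choose_spec]

lemma entropy_nonneg [IsProbabilityMeasure μ] [Fintype S] (V : Ω → S) : 0 ≤ entropy μ V :=
  Finset.sum_nonneg fun _ _ => Real.negMulLog_nonneg measureReal_nonneg measureReal_le_one

lemma negMulLog_sum_le {ι : Type*} (s : Finset ι) (p : ι → ℝ) (hp : ∀ i ∈ s, 0 ≤ p i) :
    Real.negMulLog (∑ i ∈ s, p i) ≤ ∑ i ∈ s, Real.negMulLog (p i) := by
  rw [Real.negMulLog, ← Finset.sum_neg_distrib, Finset.sum_mul]
  refine Finset.sum_le_sum fun i hi => ?_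
  rw [Real.negMulLog, neg_mul, neg_mul, neg_le_neg_iff]
  rcases (hp i hi).eq_or_lt with h | h
  · simp [← h]
  · exact mul_le_mul_of_nonneg_left
      (Real.log_le_log h (Finset.single_le_sum hp hi)) h.le

lemma entropy_le_entropy_prod [IsFiniteMeasure μ] [Fintype S] [Fintype T] [MeasurableSpace T]
    [MeasurableSingletonClass T] (V : Ω → S) {W : Ω → T} (hW : Measurable W) :
    entropy μ V ≤ entropy μ (fun ω => (V ω, W ω)) := by
  unfold entropy
  rw [Fintype.sum_prod_type]
  refine Finset.sum_le_sum fun v _ => ?_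
  rw [← sum_measureReal_prod_right hW V v]
  exact negMulLog_sum_le _ _ fun _ _ => measureReal_nonneg

/-- The entropy of a function of `W` is at most the entropy of `W`. -/
lemma entropy_le_of_ker [IsFiniteMeasure μ] [Fintype S] [Fintype T] [MeasurableSpace T]
    [MeasurableSingletonClass T] {V : Ω → S} {W : Ω → T} (hW : Measurable W)
    (h : ∀ ω ω', W ω = W ω' → V ω = V ω') : entropy μ V ≤ entropy μ W := by
  refine (entropy_le_entropy_prod V hW).trans (entropy_congr_of_ker fun ω ω' => ?_).le
  simp only [Prod.mk.injEq, and_iff_right_iff_imp]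
  exact h ω ω'

/-- Gibbs' inequality. -/
lemma sum_negMulLog_le {ι : Type*} [Fintype ι] (p q : ι → ℝ) (hp : ∀ i, 0 ≤ p i)
    (hq : ∀ i, 0 ≤ q i) (hpq : ∀ i, q i = 0 → p i = 0) (hsum : ∑ i, q i ≤ ∑ i, p i) :
    ∑ i, Real.negMulLog (p i) ≤ -∑ i, p i * Real.log (q i) := by
  have h : ∀ i, Real.negMulLog (p i) + p i * Real.log (q i) ≤ q i - p i := by
    intro i
    rcases (hp i).eq_or_lt with h0 | h0
    · simp [← h0, hq i]
    · have hqi : 0 < q i := (hq i).lt_of_ne fun e => h0.ne' (hpq i e.symm)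
      have h1 := Real.log_le_sub_one_of_pos (div_pos hqi h0)
      rw [Real.log_div hqi.ne' h0.ne'] at h1
      have h2 := mul_le_mul_of_nonneg_left h1 h0.le
      have h3 : p i * (q i / p i - 1) = q i - p i := by field_simp
      rw [h3] at h2
      rw [Real.negMulLog]
      linarith
  have := Finset.sum_le_sum fun i (_ : i ∈ Finset.univ) => h i
  rw [Finset.sum_add_distrib, Finset.sum_sub_distrib] at this
  linarith

lemma sum_negMulLog_le_log_card {ι : Type*} [Fintype ι] (p : ι → ℝ) (hp : ∀ i, 0 ≤ p i)
    (hsum : ∑ i, p i = 1) : ∑ i, Real.negMulLog (p i) ≤ Real.log (Fintype.card ι) := by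
  have hne : Nonempty ι := by
    by_contra hc
    rw [not_nonempty_iff] at hc
    simp at hsum
  have hc : (0 : ℝ) < Fintype.card ι := by exact_mod_cast Fintype.card_pos
  have := sum_negMulLog_le p (fun _ => (Fintype.card ι : ℝ)⁻¹) hp (fun _ => by positivity)
    (fun _ h => by simp [hc.ne'] at h) (by simp [hsum, hc.ne'])
  rwa [← Finset.sum_mul, hsum, Real.log_inv, one_mul, neg_neg] at this

/-- Gibbs' inequality, comparing the joint law with the product of its marginals. The joint law
vanishes wherever a marginal does, which takes care of `log 0`. -/
lemma entropy_prod_le [IsProbabilityMeasure μ] [Fintype S] [MeasurableSpace S]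
    [MeasurableSingletonClass S] [Fintype T] [MeasurableSpace T] [MeasurableSingletonClass T]
    {V : Ω → S} {W : Ω → T} (hV : Measurable V) (hW : Measurable W) :
    entropy μ (fun ω => (V ω, W ω)) ≤ entropy μ V + entropy μ W := by
  set p : S → ℝ := fun v => μ.real {ω | V ω = v} with hp
  set q : T → ℝ := fun w => μ.real {ω | W ω = w} with hq
  set r : S × T → ℝ := fun x => μ.real {ω | (V ω, W ω) = x} with hr
  have rp : ∀ v w, r (v, w) ≤ p v := fun v w =>
    measureReal_mono fun ω h => (Prod.ext_iff.1 h).1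
  have rq : ∀ v w, r (v, w) ≤ q w := fun v w =>
    measureReal_mono fun ω h => (Prod.ext_iff.1 h).2
  have r0 : ∀ x, 0 ≤ r x := fun _ => measureReal_nonneg
  have sp : ∑ v, p v = 1 := sum_measureReal_eq_one hV
  have sq : ∑ w, q w = 1 := sum_measureReal_eq_one hW
  have sr : ∑ x, r x = 1 := sum_measureReal_eq_one (hV.prodMk hW)
  have z : ∀ v w, p v = 0 ∨ q w = 0 → r (v, w) = 0 := by
    rintro v w (h | h)
    · exact le_antisymm (h ▸ rp v w) (r0 _)
    · exact le_antisymm (h ▸ rq v w) (r0 _)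
  have g := sum_negMulLog_le r (fun x => p x.1 * q x.2) r0
    (fun x => mul_nonneg measureReal_nonneg measureReal_nonneg)
    (fun x h => z x.1 x.2 (mul_eq_zero.1 h))
    (by rw [sr, Fintype.sum_prod_type]; simp [← Finset.mul_sum, sp, sq])
  refine g.trans_eq ?_
  have e : ∀ x : S × T, r x * Real.log (p x.1 * q x.2) =
      r x * Real.log (p x.1) + r x * Real.log (q x.2) := by
    intro x
    by_cases h : p x.1 = 0 ∨ q x.2 = 0
    · have : r x = 0 := z x.1 x.2 h
      simp [this]
    · push Not at h
      rw [Real.log_mul h.1 h.2, mul_add]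
  simp_rw [e]
  rw [Finset.sum_add_distrib, Fintype.sum_prod_type, Fintype.sum_prod_type_right]
  have e1 : ∀ v, ∑ w, r (v, w) = p v := sum_measureReal_prod_right hW V
  have e2 : ∀ w, ∑ v, r (v, w) = q w := sum_measureReal_prod_left hV W
  simp only [← Finset.sum_mul, e1, e2]
  simp only [entropy, Real.negMulLog, neg_mul, Finset.sum_neg_distrib]
  ring

/-- The entropy of a variable determined by `V` and `W` is at most `H(V) + H(W)`. -/
lemma entropy_le_add_of_ker [IsProbabilityMeasure μ] [Fintype R] [Fintype S] [MeasurableSpace S]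
    [MeasurableSingletonClass S] [Fintype T] [MeasurableSpace T] [MeasurableSingletonClass T]
    {V : Ω → S} {W : Ω → T} {U : Ω → R} (hV : Measurable V) (hW : Measurable W)
    (h : ∀ ω ω', V ω = V ω' → W ω = W ω' → U ω = U ω') :
    entropy μ U ≤ entropy μ V + entropy μ W :=
  (entropy_le_of_ker (hV.prodMk hW) fun ω ω' e =>
    h ω ω' (Prod.ext_iff.1 e).1 (Prod.ext_iff.1 e).2).trans (entropy_prod_le hV hW)

open Classical in
/-- The law of a function of a finite variable. -/
lemma measureReal_comp [IsFiniteMeasure μ] [Fintype S] [MeasurableSpace S]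
    [MeasurableSingletonClass S] {V : Ω → S} (hV : Measurable V) (g : S → T) (t : T) :
    μ.real {ω | g (V ω) = t} = ∑ v, if g v = t then μ.real {ω | V ω = v} else 0 := by
  rw [measureReal_eq_sum_fiber hV]
  refine Finset.sum_congr rfl fun v _ => ?_
  split_ifs with hv
  · congr 1
    ext ω
    simp only [Set.mem_ofPred_eq, and_iff_right_iff_imp]
    rintro rfl
    exact hv
  · rw [show {ω | ω ∈ {ω | g (V ω) = t} ∧ V ω = v} = ∅ from ?_, measureReal_empty]
    ext ω
    simp only [Set.mem_ofPred_eq, Set.mem_empty_iff_false, iff_false, not_and]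
    rintro h rfl
    exact hv h

/-- Change of variables for the law of a function of a finite variable. -/
lemma sum_measureReal_comp [IsFiniteMeasure μ] [Fintype S] [MeasurableSpace S]
    [MeasurableSingletonClass S] [Fintype T] {V : Ω → S} (hV : Measurable V) (g : S → T)
    (f : T → ℝ) :
    ∑ t, μ.real {ω | g (V ω) = t} * f t = ∑ v, μ.real {ω | V ω = v} * f (g v) := by
  classical
  simp_rw [measureReal_comp hV g, Finset.sum_mul]
  rw [Finset.sum_comm]
  refine Finset.sum_congr rfl fun v _ => ?_
  simp

/-- Chain rule when the conditional law of `Z` given `W` is `q (f W)`. -/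
lemma entropy_prod_eq_of_kernel [IsFiniteMeasure μ] [Fintype T] [MeasurableSpace T]
    [MeasurableSingletonClass T] [Fintype S] [Fintype R] {W : Ω → T} (hW : Measurable W)
    {Z : Ω → S} (f : T → R) (q : R → S → ℝ)
    (h : ∀ w z, μ.real {ω | W ω = w ∧ Z ω = z} = μ.real {ω | W ω = w} * q (f w) z)
    (hq : ∀ w, μ.real {ω | W ω = w} ≠ 0 → ∑ z, q (f w) z = 1) :
    entropy μ (fun ω => (W ω, Z ω)) = entropy μ W +
      ∑ s, μ.real {ω | f (W ω) = s} * ∑ z, Real.negMulLog (q s z) := by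
  rw [sum_measureReal_comp hW f (fun s => ∑ z, Real.negMulLog (q s z))]
  unfold entropy
  rw [Fintype.sum_prod_type, ← Finset.sum_add_distrib]
  refine Finset.sum_congr rfl fun w _ => ?_
  simp only [Prod.mk.injEq, h, Real.negMulLog_mul]
  rw [Finset.sum_add_distrib, ← Finset.sum_mul, ← Finset.mul_sum]
  by_cases h0 : μ.real {ω | W ω = w} = 0
  · simp [h0]
  · rw [hq w h0, one_mul]

/-- The law of a function of `W`, jointly with `V`, when the conditional law of `V` given `W`
depends on that function only. -/
lemma measureReal_kernel_of_ker [IsFiniteMeasure μ] [Fintype T] [MeasurableSpace T]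
    [MeasurableSingletonClass T] {W : Ω → T} (hW : Measurable W)
    {V : Ω → S} {U' : Ω → U} (c : T → R) (f : U → R) (q : R → S → ℝ)
    (h : ∀ w v, μ.real {ω | W ω = w ∧ V ω = v} = μ.real {ω | W ω = w} * q (c w) v)
    (hU : ∀ ω ω', W ω = W ω' → U' ω = U' ω') (hf : ∀ ω, f (U' ω) = c (W ω)) (u : U) (v : S) :
    μ.real {ω | U' ω = u ∧ V ω = v} = μ.real {ω | U' ω = u} * q (f u) v := by
  rw [measureReal_eq_sum_fiber hW, measureReal_eq_sum_fiber hW {ω | U' ω = u}, Finset.sum_mul]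
  refine Finset.sum_congr rfl fun w _ => ?_
  -- `U'` is constant on each fibre of `W`, so the fibre lies inside the event `U' = u` or misses
  -- it.
  by_cases hw : ∃ ω, W ω = w ∧ U' ω = u
  · obtain ⟨ω₀, rfl, rfl⟩ := hw
    have e1 : {ω | ω ∈ {ω | U' ω = U' ω₀ ∧ V ω = v} ∧ W ω = W ω₀} =
        {ω | W ω = W ω₀ ∧ V ω = v} := by
      ext ω
      simp only [Set.mem_ofPred_eq]
      exact ⟨fun h => ⟨h.2, h.1.2⟩, fun h => ⟨⟨hU _ _ h.1, h.2⟩, h.1⟩⟩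
    have e2 : {ω | ω ∈ {ω | U' ω = U' ω₀} ∧ W ω = W ω₀} = {ω | W ω = W ω₀} := by
      ext ω
      simp only [Set.mem_ofPred_eq]
      exact ⟨fun h => h.2, fun h => ⟨hU _ _ h, h⟩⟩
    rw [e1, e2, h, hf]
  · push Not at hw
    have e1 : {ω | ω ∈ {ω | U' ω = u ∧ V ω = v} ∧ W ω = w} = ∅ := by
      ext ω
      simp only [Set.mem_ofPred_eq, Set.mem_empty_iff_false, iff_false]
      exact fun h => hw ω h.2 h.1.1
    have e2 : {ω | ω ∈ {ω | U' ω = u} ∧ W ω = w} = ∅ := by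
      ext ω
      simp only [Set.mem_ofPred_eq, Set.mem_empty_iff_false, iff_false]
      exact fun h => hw ω h.2 h.1
    rw [e1, e2]
    simp

/-- Entropies of functions of variables whose laws converge. -/
lemma tendsto_entropy_comp {Ω' ι : Type*} [MeasurableSpace Ω'] {μ' : Measure Ω'}
    [IsFiniteMeasure μ] [IsFiniteMeasure μ'] {l : Filter ι} [Fintype S] [MeasurableSpace S]
    [MeasurableSingletonClass S] [Fintype T] {V : ι → Ω → S} {V' : Ω' → S}
    (hV : ∀ᶠ n in l, Measurable (V n)) (hV' : Measurable V')
    (h : ∀ v, Tendsto (fun n => μ.real {ω | V n ω = v}) l (𝓝 (μ'.real {ω | V' ω = v})))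
    (g : S → T) :
    Tendsto (fun n => entropy μ (fun ω => g (V n ω))) l (𝓝 (entropy μ' fun ω => g (V' ω))) := by
  refine tendsto_finsetSum _ fun t _ => (Real.continuous_negMulLog.tendsto _).comp ?_
  rw [measureReal_comp hV' g t]
  refine (tendsto_finsetSum _ fun v _ => ?_).congr'
    (hV.mono fun n hn => (measureReal_comp hn g t).symm)
  split_ifs
  · exact h v
  · exact tendsto_const_nhds

lemma entropy_comp_congr [IsFiniteMeasure μ] [Fintype S] [MeasurableSpace S]
    [MeasurableSingletonClass S] [Fintype T] {V V' : Ω → S} (hV : Measurable V)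
    (hV' : Measurable V') (h : ∀ v, μ.real {ω | V ω = v} = μ.real {ω | V' ω = v}) (g : S → T) :
    entropy μ (fun ω => g (V ω)) = entropy μ (fun ω => g (V' ω)) := by
  simp only [entropy, measureReal_comp hV, measureReal_comp hV', h]

/-- Conditional entropy of the second component given the first one and the past, when the
conditional law of the pair given the past `W` is `q (f W)`. -/
lemma entropy_prod_sub_eq_of_kernel {A B : Type*} [IsFiniteMeasure μ] [Fintype T]
    [MeasurableSpace T] [MeasurableSingletonClass T] [Fintype A] [Fintype B] [MeasurableSpace B]
    [MeasurableSingletonClass B] [Fintype R] {W : Ω → T} (hW : Measurable W)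
    {X : Ω → A} {Y : Ω → B} (hY : Measurable Y) (f : T → R) (q : R → A × B → ℝ)
    (hq : ∀ s, ∑ z, q s z = 1)
    (h : ∀ w z, μ.real {ω | W ω = w ∧ (X ω, Y ω) = z} = μ.real {ω | W ω = w} * q (f w) z) :
    entropy μ (fun ω => (W ω, (X ω, Y ω))) - entropy μ (fun ω => (W ω, X ω)) =
      ∑ s, μ.real {ω | f (W ω) = s} * (∑ z, Real.negMulLog (q s z) -
        ∑ a, Real.negMulLog (∑ b, q s (a, b))) := by
  rw [entropy_prod_eq_of_kernel hW f q h fun w _ => hq _,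
    entropy_prod_eq_of_kernel hW (Z := X) f (fun s a => ∑ b, q s (a, b)) ?_ fun w _ => by
      rw [← Fintype.sum_prod_type, hq]]
  · simp only [mul_sub, Finset.sum_sub_distrib]
    ring
  · intro w a
    rw [measureReal_eq_sum_fiber hY, Finset.mul_sum]
    refine Finset.sum_congr rfl fun b _ => ?_
    rw [← h]
    simp only [Set.mem_ofPred_eq, Prod.mk.injEq, and_assoc]

end EntropyLemmas

/-! ### Doeblin contraction for the chain of blocks -/

section Transition

variable {S : Type*} {k : ℕ} {Q : (Fin k → S) → S → ℝ}

lemma LeadsIn.trans {m n : ℕ} {s t u : Fin k → S} (h : LeadsIn Q m s t) (h' : LeadsIn Q n t u) :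
    LeadsIn Q (m + n) s u := by
  induction m generalizing s with
  | zero => obtain rfl : s = t := h; simpa using h'
  | succ m ih =>
    obtain ⟨z, hz, hm⟩ := h
    rw [Nat.succ_add]
    exact ⟨z, hz, ih hm⟩

lemma Leads.trans {s t u : Fin k → S} (h : Leads Q s t) (h' : Leads Q t u) : Leads Q s u :=
  let ⟨_, hm⟩ := h
  let ⟨_, hn⟩ := h'
  ⟨_, hm.trans hn⟩

lemma Leads.refl (s : Fin k → S) : Leads Q s s := ⟨0, rfl⟩

/-- A block whose set of reachable blocks has least cardinality is recurrent: a block reached from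
it reaches no fewer blocks, hence the same ones. -/
lemma exists_isRecurrent [Finite S] [Nonempty S] : ∃ s, IsRecurrent Q s := by
  obtain ⟨s, hs⟩ := Finite.exists_min fun s => {t | Leads Q s t}.ncard
  refine ⟨s, fun t ht => ?_⟩
  have hsub : {u | Leads Q t u} ⊆ {u | Leads Q s u} := fun u hu => ht.trans hu
  have := Set.eq_of_subset_of_ncard_le hsub (hs t) (Set.toFinite _)
  have h : s ∈ {u | Leads Q t u} := by rw [this]; exact Leads.refl s
  exact h

/-- Some block is reached from every block in the same number of steps. -/
lemma exists_leadsIn_uniform [Finite S] [Nonempty S] (hirr : IsIrreducible Q)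
    (haper : IsAperiodic Q) : ∃ (N : ℕ) (t : Fin k → S), ∀ s, LeadsIn Q N s t := by
  obtain ⟨t, ht⟩ := exists_isRecurrent (Q := Q)
  -- The return times to `t` have gcd one by aperiodicity, and they are closed under addition, so
  -- every large integer is a return time.
  have hgcd : Nat.setGcd {n | 1 ≤ n ∧ LeadsIn Q n t t} = 1 :=
    haper t ht _ fun n hn hl => Nat.setGcd_dvd_of_mem ⟨hn, hl⟩
  obtain ⟨n₀, hn₀⟩ := Nat.exists_mem_closure_of_ge {n | 1 ≤ n ∧ LeadsIn Q n t t}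
  have hret : ∀ n ≥ n₀, LeadsIn Q n t t := by
    intro n hn
    have hmem := hn₀ n hn (by rw [hgcd]; exact one_dvd n)
    clear hn
    induction hmem using AddSubmonoid.closure_induction with
    | mem _ h => exact h.2
    | zero => exact rfl
    | add _ _ _ _ h h' => exact h.trans h'
  choose τ hτ using fun s => hirr s t ht
  obtain ⟨M, hM⟩ := (Set.finite_range τ).bddAbove
  -- After at most `M` steps to reach `t`, at least `n₀` steps remain, which is an admissible return
  -- time.
  refine ⟨M + n₀, t, fun s => ?_⟩
  have h1 : τ s ≤ M := hM ⟨s, rfl⟩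
  have := (hτ s).trans (hret (M + n₀ - τ s) (by omega))
  rwa [show τ s + (M + n₀ - τ s) = M + n₀ by omega] at this

variable [Fintype S]

/-- The transition operator of the chain of blocks, acting on functions. -/
noncomputable def avg (Q : (Fin k → S) → S → ℝ) (f : (Fin k → S) → ℝ) (s : Fin k → S) : ℝ :=
  ∑ z, Q s z * f (nextBlock s z)

lemma avg_mono (hQ : ∀ s, Q s ∈ stdSimplex ℝ S) {f g : (Fin k → S) → ℝ} (h : ∀ s, f s ≤ g s)
    (n : ℕ) (s : Fin k → S) : (avg Q)^[n] f s ≤ (avg Q)^[n] g s := by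
  induction n generalizing s with
  | zero => exact h s
  | succ n ih =>
    rw [Function.iterate_succ_apply', Function.iterate_succ_apply']
    exact Finset.sum_le_sum fun z _ => mul_le_mul_of_nonneg_left (ih _) ((hQ s).1 z)

/-- Averages fix constants because the rows of `Q` sum to one. -/
lemma avg_affine (hQ : ∀ s, Q s ∈ stdSimplex ℝ S) (a c : ℝ) (f : (Fin k → S) → ℝ)
    (n : ℕ) (s : Fin k → S) :
    (avg Q)^[n] (fun s => a + c * f s) s = a + c * (avg Q)^[n] f s := by
  induction n generalizing s with
  | zero => rfl
  | succ n ih =>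
    rw [Function.iterate_succ_apply', Function.iterate_succ_apply', avg, avg]
    simp only [ih, mul_add, Finset.sum_add_distrib, ← Finset.sum_mul, (hQ s).2, one_mul,
      Finset.mul_sum]
    congr 1
    exact Finset.sum_congr rfl fun z _ => by ring

lemma avg_bounds (hQ : ∀ s, Q s ∈ stdSimplex ℝ S) {f : (Fin k → S) → ℝ} {a b : ℝ}
    (h : ∀ s, a ≤ f s ∧ f s ≤ b) (n : ℕ) (s : Fin k → S) :
    a ≤ (avg Q)^[n] f s ∧ (avg Q)^[n] f s ≤ b := by
  have e : ∀ c, (avg Q)^[n] (fun _ => c) s = c := fun c => by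
    simpa using avg_affine hQ c 0 f n s
  constructor
  · rw [← e a]
    exact avg_mono hQ (fun s => (h s).1) n s
  · conv_rhs => rw [← e b]
    exact avg_mono hQ (fun s => (h s).2) n s

-- The iterated average of the indicator of `t` is the `n`-step transition probability to `t`.
open Classical in
lemma leadsIn_iff (hQ : ∀ s, Q s ∈ stdSimplex ℝ S) (n : ℕ) (s t : Fin k → S) :
    LeadsIn Q n s t ↔ 0 < (avg Q)^[n] (fun u => if u = t then 1 else 0) s := by
  induction n generalizing s with
  | zero =>
    simp only [LeadsIn, Function.iterate_zero, id]
    split_ifs with h <;> simp [h]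
  | succ n ih =>
    have h0 : ∀ s, 0 ≤ (avg Q)^[n] (fun u => if u = t then (1 : ℝ) else 0) s := fun s =>
      (avg_bounds hQ (a := 0) (b := 1) (fun u => by split_ifs <;> simp) n s).1
    rw [Function.iterate_succ_apply', avg, Finset.sum_pos_iff_of_nonneg
      fun z _ => mul_nonneg ((hQ s).1 z) (h0 _)]
    simp only [LeadsIn, ih, Finset.mem_univ, true_and]
    refine exists_congr fun z => ⟨fun h => mul_pos h.1 h.2, fun h => ?_⟩
    exact ⟨pos_of_mul_pos_left h (h0 _), pos_of_mul_pos_right h ((hQ s).1 z)⟩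

/-- Doeblin's contraction of the oscillation. -/
lemma exists_avg_contraction [Nonempty S] (hQ : ∀ s, Q s ∈ stdSimplex ℝ S)
    (hirr : IsIrreducible Q) (haper : IsAperiodic Q) :
    ∃ (N : ℕ) (δ : ℝ), 0 < δ ∧ δ ≤ 1 ∧ ∀ (f : (Fin k → S) → ℝ) (a b : ℝ),
      (∀ s, a ≤ f s ∧ f s ≤ b) → ∃ a' b', b' - a' = (1 - δ) * (b - a) ∧
        ∀ s, a' ≤ (avg Q)^[N] f s ∧ (avg Q)^[N] f s ≤ b' := by
  classical
  obtain ⟨N, t, hN⟩ := exists_leadsIn_uniform hirr haper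
  set I : (Fin k → S) → ℝ := fun u => if u = t then 1 else 0 with hI
  obtain ⟨s₀, hs₀⟩ := Finite.exists_min fun s => (avg Q)^[N] I s
  have I1 := avg_bounds hQ (f := I) (a := 0) (b := 1)
    (fun u => by simp only [hI]; split_ifs <;> simp) N
  refine ⟨N, (avg Q)^[N] I s₀, (leadsIn_iff hQ _ _ _).1 (hN s₀), (I1 s₀).2, fun f a b h => ?_⟩
  set δ := (avg Q)^[N] I s₀
  -- Pointwise, `f` is at least `a + (f t - a) * I` and at most `b + (f t - b) * I`. After `N` steps
  -- `I` averages to at least `δ` everywhere, and `f t` cancels in the difference of the new bounds.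
  refine ⟨a + (f t - a) * δ, b + (f t - b) * δ, by ring, fun s => ⟨?_, ?_⟩⟩
  · have h1 := avg_mono hQ (f := fun s => a + (f t - a) * I s) (g := f) (fun s => by
      simp only [hI]
      split_ifs with e
      · simp [e]
      · simpa using (h s).1) N s
    rw [avg_affine hQ] at h1
    nlinarith [hs₀ s, (h t).1]
  · have h1 := avg_mono hQ (g := fun s => b + (f t - b) * I s) (f := f) (fun s => by
      simp only [hI]
      split_ifs with e
      · simp [e]
      · simpa using (h s).2) N s
    rw [avg_affine hQ] at h1
    nlinarith [hs₀ s, (h t).2]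

/-- The iterated averages of a function become constant. -/
lemma avg_eventually_near_const [Nonempty S] (hQ : ∀ s, Q s ∈ stdSimplex ℝ S)
    (hirr : IsIrreducible Q) (haper : IsAperiodic Q) (f : (Fin k → S) → ℝ) {ε : ℝ} (hε : 0 < ε) :
    ∃ M, ∀ n ≥ M, ∃ a, ∀ s, a ≤ (avg Q)^[n] f s ∧ (avg Q)^[n] f s ≤ a + ε := by
  obtain ⟨N, δ, hδ, hδ1, hc⟩ := exists_avg_contraction hQ hirr haper
  obtain ⟨i, hi⟩ := Finite.exists_min f
  obtain ⟨j, hj⟩ := Finite.exists_max f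
  have hpow : ∀ m : ℕ, ∃ a b, b - a = (1 - δ) ^ m * (f j - f i) ∧
      ∀ s, a ≤ (avg Q)^[N * m] f s ∧ (avg Q)^[N * m] f s ≤ b := by
    intro m
    induction m with
    | zero => exact ⟨f i, f j, by simp, fun s => by simpa using ⟨hi s, hj s⟩⟩
    | succ m ih =>
      obtain ⟨a, b, hab, h⟩ := ih
      obtain ⟨a', b', hab', h'⟩ := hc _ a b h
      refine ⟨a', b', by rw [hab', hab]; ring, fun s => ?_⟩
      rw [Nat.mul_succ, add_comm, Function.iterate_add_apply]
      exact h' s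
  have ht : Tendsto (fun m : ℕ => (1 - δ) ^ m * (f j - f i)) atTop (𝓝 0) := by
    simpa using (tendsto_pow_atTop_nhds_zero_of_lt_one (by linarith) (by linarith)).mul_const
      (f j - f i)
  obtain ⟨m, hm⟩ := (ht.eventually_lt_const hε).exists
  obtain ⟨a, b, hab, h⟩ := hpow m
  -- Further averaging cannot leave the interval from `a` to `b`, so the bound persists after time
  -- `N * m`.
  refine ⟨N * m, fun n hn => ⟨a, fun s => ?_⟩⟩
  have := avg_bounds hQ h (n - N * m) s
  rw [← Function.iterate_add_apply, Nat.sub_add_cancel hn] at this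
  exact ⟨this.1, by linarith [this.2]⟩

end Transition

/-! ### Windows of a process -/

section Blocks

variable {Ω S : Type*}

/-- Reduces questions of which window determines which to inclusions of integer intervals. -/
lemma block_eq_block_iff {Z : ℤ → Ω → S} {i : ℤ} {m : ℕ} {ω ω' : Ω} :
    block Z i m ω = block Z i m ω' ↔ ∀ t : ℤ, i ≤ t → t < i + m → Z t ω = Z t ω' := by
  simp only [block, funext_iff]
  constructor
  · intro h t h1 h2
    have := h ⟨(t - i).toNat, by omega⟩
    rwa [show i + (((t - i).toNat : ℕ) : ℤ) = t by omega] at this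
  · intro h j
    exact h _ (by omega) (by omega)

lemma measurable_block [MeasurableSpace Ω] [MeasurableSpace S] {Z : ℤ → Ω → S} {i : ℤ}
    (hZ : ∀ n, i ≤ n → Measurable (Z n)) (m : ℕ) : Measurable (block Z i m) :=
  measurable_pi_iff.2 fun _ => hZ _ (by omega)

lemma nextBlock_block {k : ℕ} (Z : ℤ → Ω → S) (n : ℤ) (ω : Ω) :
    nextBlock (block Z (n + 1 - k) k ω) (Z (n + 1) ω) = block Z (n + 1 + 1 - k) k ω := by
  ext j
  simp only [nextBlock, block]
  split_ifs with h
  · congr 1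
    push_cast
    ring
  · congr 1
    omega

lemma block_natAdd {k : ℕ} (Z : ℤ → Ω → S) (n : ℕ) (ω : Ω) :
    (fun j : Fin k => block Z (1 - (k : ℤ)) (n + k) ω (Fin.natAdd n j)) =
      block Z ((n : ℤ) + 1 - k) k ω := by
  ext j
  simp only [block, Fin.val_natAdd]
  congr 1
  push_cast
  ring

end Blocks

/-! ### Laws of the chain and convergence to stationarity -/

section Chain

variable {Ω S T : Type*} [MeasurableSpace Ω] {μ : Measure Ω}
  [Fintype S] [MeasurableSpace S] [MeasurableSingletonClass S]
  {k : ℕ} {Q : (Fin k → S) → S → ℝ} {Z : ℤ → Ω → S}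

/-- The transition law given any function of the past that determines the last `k` symbols. -/
lemma IsMarkovChain.measureReal_of_ker [IsFiniteMeasure μ] (hZ : IsMarkovChain μ Z k Q)
    (hm : ∀ n : ℤ, 1 - (k : ℤ) ≤ n → Measurable (Z n)) (n : ℕ) {U : Ω → T}
    (f : T → Fin k → S)
    (hU : ∀ ω ω', block Z (1 - (k : ℤ)) (n + k) ω = block Z (1 - (k : ℤ)) (n + k) ω' → U ω = U ω')
    (hf : ∀ ω, f (U ω) = block Z ((n : ℤ) + 1 - k) k ω) (u : T) (z : S) :
    μ.real {ω | U ω = u ∧ Z ((n : ℤ) + 1) ω = z} = μ.real {ω | U ω = u} * Q (f u) z :=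
  measureReal_kernel_of_ker (measurable_block hm _)
    (fun (w : Fin (n + k) → S) (j : Fin k) => w (Fin.natAdd n j)) f Q
    (hZ n) hU (fun ω => by rw [hf, block_natAdd]) u z

lemma IsMarkovChain.measureReal_block [IsFiniteMeasure μ] (hZ : IsMarkovChain μ Z k Q)
    (hm : ∀ n : ℤ, 1 - (k : ℤ) ≤ n → Measurable (Z n)) (n : ℕ) (s : Fin k → S) (z : S) :
    μ.real {ω | block Z ((n : ℤ) + 1 - k) k ω = s ∧ Z ((n : ℤ) + 1) ω = z} =
      μ.real {ω | block Z ((n : ℤ) + 1 - k) k ω = s} * Q s z :=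
  hZ.measureReal_of_ker hm n (U := block Z ((n : ℤ) + 1 - k) k) id
    (fun ω ω' h => by
      rw [block_eq_block_iff] at h ⊢
      exact fun t h1 h2 => h t (by omega) (by push_cast; omega)) (fun _ => rfl) s z

lemma IsMarkovChain.sum_law_succ [IsFiniteMeasure μ] (hZ : IsMarkovChain μ Z k Q)
    (hm : ∀ n : ℤ, 1 - (k : ℤ) ≤ n → Measurable (Z n)) (n : ℕ) (f : (Fin k → S) → ℝ) :
    ∑ s, μ.real {ω | block Z (((n + 1 : ℕ) : ℤ) + 1 - k) k ω = s} * f s =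
      ∑ s, μ.real {ω | block Z ((n : ℤ) + 1 - k) k ω = s} * avg Q f s := by
  have hV : Measurable fun ω => (block Z ((n : ℤ) + 1 - k) k ω, Z ((n : ℤ) + 1) ω) :=
    (measurable_block (fun i hi => hm i (by omega)) k).prodMk (hm _ (by omega))
  have h := sum_measureReal_comp (μ := μ) hV (fun x => nextBlock x.1 x.2) f
  simp only [nextBlock_block] at h
  push_cast
  rw [h, Fintype.sum_prod_type]
  refine Finset.sum_congr rfl fun s _ => ?_
  rw [avg, Finset.mul_sum]
  refine Finset.sum_congr rfl fun z _ => ?_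
  simp only [Prod.mk.injEq]
  rw [hZ.measureReal_block hm]
  ring

/-- By duality the time dependence moves from the law to the test function, where the contraction
applies whatever the initial law. -/
lemma IsMarkovChain.sum_law [IsFiniteMeasure μ] (hZ : IsMarkovChain μ Z k Q)
    (hm : ∀ n : ℤ, 1 - (k : ℤ) ≤ n → Measurable (Z n)) (n : ℕ) (f : (Fin k → S) → ℝ) :
    ∑ s, μ.real {ω | block Z ((n : ℤ) + 1 - k) k ω = s} * f s =
      ∑ s, μ.real {ω | block Z (1 - (k : ℤ)) k ω = s} * (avg Q)^[n] f s := by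
  induction n generalizing f with
  | zero => simp
  | succ n ih => rw [hZ.sum_law_succ hm, ih, Function.iterate_succ_apply]

/-- Convergence to the stationary law. -/
lemma IsMarkovChain.tendsto_law {Ω' : Type*} [MeasurableSpace Ω'] {μ' : Measure Ω'}
    [IsProbabilityMeasure μ] [IsProbabilityMeasure μ'] {Z' : ℤ → Ω' → S}
    (hQ : ∀ s, Q s ∈ stdSimplex ℝ S) (hirr : IsIrreducible Q) (haper : IsAperiodic Q)
    (hZ : IsMarkovChain μ Z k Q)
    (hm : ∀ n : ℤ, 1 - (k : ℤ) ≤ n → Measurable (Z n))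
    (hZ' : IsMarkovChain μ' Z' k Q) (hm' : ∀ n : ℤ, Measurable (Z' n))
    (hstat : IsStationary μ' Z') (i : ℤ) (s : Fin k → S) :
    Tendsto (fun n : ℕ => μ.real {ω | block Z ((n : ℤ) + 1 - k) k ω = s}) atTop
      (𝓝 (μ'.real {ω | block Z' i k ω = s})) := by
  classical
  obtain ⟨ω₀⟩ : Nonempty Ω := nonempty_of_isProbabilityMeasure μ
  have : Nonempty S := ⟨Z 0 ω₀⟩
  set f : (Fin k → S) → ℝ := fun t => if t = s then 1 else 0 with hf
  have h1 : ∀ n : ℕ, μ.real {ω | block Z ((n : ℤ) + 1 - k) k ω = s} =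
      ∑ s, μ.real {ω | block Z (1 - (k : ℤ)) k ω = s} * (avg Q)^[n] f s := fun n => by
    rw [← hZ.sum_law hm]
    simp [hf]
  have h2 : ∀ n : ℕ, μ'.real {ω | block Z' i k ω = s} =
      ∑ s, μ'.real {ω | block Z' (1 - (k : ℤ)) k ω = s} * (avg Q)^[n] f s := fun n => by
    rw [← hZ'.sum_law fun n _ => hm' n, hstat i ((n : ℤ) + 1 - k)]
    simp [hf]
  have bd : ∀ (p g : (Fin k → S) → ℝ) (a b : ℝ), (∀ s, 0 ≤ p s) → ∑ s, p s = 1 →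
      (∀ s, a ≤ g s ∧ g s ≤ b) → a ≤ ∑ s, p s * g s ∧ ∑ s, p s * g s ≤ b := by
    intro p g a b hp hs hg
    constructor
    · calc a = ∑ s, p s * a := by rw [← Finset.sum_mul, hs, one_mul]
        _ ≤ _ := Finset.sum_le_sum fun s _ => mul_le_mul_of_nonneg_left (hg s).1 (hp s)
    · calc _ ≤ ∑ s, p s * b :=
            Finset.sum_le_sum fun s _ => mul_le_mul_of_nonneg_left (hg s).2 (hp s)
        _ = b := by rw [← Finset.sum_mul, hs, one_mul]
  rw [Metric.tendsto_atTop]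
  intro ε hε
  obtain ⟨M, hM⟩ := avg_eventually_near_const hQ hirr haper f (half_pos hε)
  refine ⟨M, fun n hn => ?_⟩
  obtain ⟨a, ha⟩ := hM n hn
  -- Both probabilities are averages of the same function, whose values lie in an interval of length
  -- `ε / 2`.
  rw [h1 n, h2 n, Real.dist_eq, abs_lt]
  have b1 := bd (fun s => μ.real {ω | block Z (1 - (k : ℤ)) k ω = s}) _ _ _
    (fun _ => measureReal_nonneg) (sum_measureReal_eq_one (measurable_block hm k)) ha
  have b2 := bd (fun s => μ'.real {ω | block Z' (1 - (k : ℤ)) k ω = s}) _ _ _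
    (fun _ => measureReal_nonneg)
    (sum_measureReal_eq_one (measurable_block (fun n _ => hm' n) k)) ha
  constructor <;> linarith [b1.1, b1.2, b2.1, b2.2]

/-- A stationary chain has the given transition law at every time. -/
lemma IsMarkovChain.measureReal_block_of_stationary [IsFiniteMeasure μ]
    (hZ : IsMarkovChain μ Z k Q) (hm : ∀ n : ℤ, Measurable (Z n)) (hstat : IsStationary μ Z)
    (i : ℤ) (s : Fin k → S) (z : S) :
    μ.real {ω | block Z i k ω = s ∧ Z (i + k) ω = z} =
      μ.real {ω | block Z i k ω = s} * Q s z := by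
  -- The joint event concerns one block of length `k + 1`, so stationarity can move it.
  have e : ∀ j : ℤ, {ω | block Z j k ω = s ∧ Z (j + k) ω = z} =
      {ω | block Z j (k + 1) ω = Fin.snoc (α := fun _ => S) s z} := by
    intro j
    ext ω
    simp only [Set.mem_ofPred_eq, funext_iff, Fin.forall_fin_succ', Fin.snoc_castSucc,
      Fin.snoc_last, block, Fin.val_castSucc, Fin.val_last]
  have h := hZ.measureReal_block (fun n _ => hm n) 0 s z
  rw [e i, hstat i (1 - k), ← e, hstat i (1 - k)]
  simpa using h

end Chain

/-! ### Output laws given the current block -/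

section Emission

variable {Ω A B : Type*} {k : ℕ}

/-- Probability that the chain of pairs started from the block `s` emits `y` as its next
second components. -/
noncomputable def emissionProb [Fintype A] (Q : (Fin k → A × B) → A × B → ℝ) :
    (n : ℕ) → (Fin k → A × B) → (Fin n → B) → ℝ
  | 0, _, _ => 1
  | n + 1, s, y => ∑ a, Q s (a, y 0) * emissionProb Q n (nextBlock s (a, y 0)) (Fin.tail y)

lemma IsMarkovChain.measureReal_emission [Fintype A] [MeasurableSpace A]
    [MeasurableSingletonClass A] {Q : (Fin k → A × B) → A × B → ℝ} [MeasurableSpace Ω]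
    {μ : Measure Ω} [IsFiniteMeasure μ] {X : ℤ → Ω → A} {Y : ℤ → Ω → B}
    (hX : ∀ n : ℤ, 1 - (k : ℤ) ≤ n → Measurable (X n))
    (hXY : IsMarkovChain μ (fun n ω => (X n ω, Y n ω)) k Q) (n m : ℕ)
    (w : Fin (m + k) → A × B) (y : Fin n → B) :
    μ.real {ω | block (fun n ω => (X n ω, Y n ω)) (1 - (k : ℤ)) (m + k) ω = w ∧
        block Y ((m : ℤ) + 1) n ω = y} =
      μ.real {ω | block (fun n ω => (X n ω, Y n ω)) (1 - (k : ℤ)) (m + k) ω = w} *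
        emissionProb Q n (fun j => w (Fin.natAdd m j)) y := by
  induction n generalizing m with
  | zero =>
    simp only [emissionProb, mul_one]
    congr 1
    ext ω
    simp [eq_iff_true_of_subsingleton]
  | succ n ih =>
    rw [measureReal_eq_sum_fiber (hX ((m : ℤ) + 1) (by omega)), emissionProb, Finset.mul_sum]
    refine Finset.sum_congr rfl fun a _ => ?_
    -- The past `w` extended by the pair `(a, y 0)`, with `a` the unobserved input; the induction
    -- hypothesis is applied to this longer past.
    set w' : Fin (m + 1 + k) → A × B := fun j =>
      if h : (j : ℕ) < m + k then w ⟨j, h⟩ else (a, y 0) with hw'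
    have e0 : ∀ ω, block (fun n ω => (X n ω, Y n ω)) (1 - (k : ℤ)) (m + 1 + k) ω = w' ↔
        block (fun n ω => (X n ω, Y n ω)) (1 - (k : ℤ)) (m + k) ω = w ∧
          (X ((m : ℤ) + 1) ω, Y ((m : ℤ) + 1) ω) = (a, y 0) := by
      intro ω
      simp only [funext_iff, block, hw']
      constructor
      · intro h
        refine ⟨fun j => ?_, ?_⟩
        · simpa using h ⟨j, by omega⟩
        · have := h ⟨m + k, by omega⟩
          simp only [lt_irrefl, dite_false] at this
          rw [← this]
          rw [show 1 - (k : ℤ) + ((m + k : ℕ) : ℤ) = (m : ℤ) + 1 by push_cast; ring]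
      · rintro ⟨h1, h2⟩ j
        split_ifs with hj
        · exact h1 ⟨j, hj⟩
        · rw [← h2, show 1 - (k : ℤ) + ((j : ℕ) : ℤ) = (m : ℤ) + 1 by omega]
    have e1 : {ω | ω ∈ {ω | block (fun n ω => (X n ω, Y n ω)) (1 - (k : ℤ)) (m + k) ω = w ∧
          block Y ((m : ℤ) + 1) (n + 1) ω = y} ∧ X ((m : ℤ) + 1) ω = a} =
        {ω | block (fun n ω => (X n ω, Y n ω)) (1 - (k : ℤ)) (m + 1 + k) ω = w' ∧
          block Y (((m + 1 : ℕ) : ℤ) + 1) n ω = Fin.tail y} := by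
      ext ω
      simp only [Set.mem_ofPred_eq, e0, Prod.mk.injEq]
      have : block Y ((m : ℤ) + 1) (n + 1) ω = y ↔
          Y ((m : ℤ) + 1) ω = y 0 ∧ block Y (((m + 1 : ℕ) : ℤ) + 1) n ω = Fin.tail y := by
        simp only [funext_iff, Fin.forall_fin_succ, block, Fin.tail]
        refine and_congr (by simp) (forall_congr' fun j => ?_)
        rw [show (m : ℤ) + 1 + ((j.succ : ℕ) : ℤ) = ((m + 1 : ℕ) : ℤ) + 1 + ((j : ℕ) : ℤ) by
          simp; ring]
      rw [this]
      tauto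
    have e2 : (fun j => w' (Fin.natAdd (m + 1) j)) =
        nextBlock (fun j => w (Fin.natAdd m j)) (a, y 0) := by
      ext1 j
      simp only [hw', nextBlock, Fin.val_natAdd]
      by_cases hj : (j : ℕ) + 1 < k
      · rw [dif_pos hj, dif_pos (by omega)]
        congr 1
        ext
        simp
        omega
      · rw [dif_neg hj, dif_neg (by omega)]
    rw [e1, ih, e2]
    simp only [e0]
    rw [hXY m w (a, y 0), mul_assoc]

variable [Fintype A] [Fintype B] {Q : (Fin k → A × B) → A × B → ℝ}

lemma emissionProb_nonneg (hQ : ∀ s, Q s ∈ stdSimplex ℝ (A × B)) (n : ℕ) (s : Fin k → A × B)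
    (y : Fin n → B) : 0 ≤ emissionProb Q n s y := by
  induction n generalizing s with
  | zero => exact zero_le_one
  | succ n ih => exact Finset.sum_nonneg fun a _ => mul_nonneg ((hQ s).1 _) (ih _ _)

lemma sum_emissionProb (hQ : ∀ s, Q s ∈ stdSimplex ℝ (A × B)) (n : ℕ) (s : Fin k → A × B) :
    ∑ y, emissionProb Q n s y = 1 := by
  induction n generalizing s with
  | zero => simp [emissionProb]
  | succ n ih =>
    rw [← (Fin.consEquiv fun _ : Fin (n + 1) => B).sum_comp, Fintype.sum_prod_type]
    simp only [emissionProb, Fin.consEquiv, Equiv.coe_fn_mk, Fin.cons_zero, Fin.tail_cons]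
    have h := (hQ s).2
    rw [Fintype.sum_prod_type_right] at h
    rw [← h]
    refine Finset.sum_congr rfl fun b _ => ?_
    rw [Finset.sum_comm]
    simp only [← Finset.mul_sum, ih, mul_one]

/-- Entropy of the output law of length `n` of the chain started from the block `s`. -/
noncomputable def emissionEntropy (Q : (Fin k → A × B) → A × B → ℝ) (n : ℕ)
    (s : Fin k → A × B) : ℝ :=
  ∑ y, Real.negMulLog (emissionProb Q n s y)

lemma emissionEntropy_nonneg (hQ : ∀ s, Q s ∈ stdSimplex ℝ (A × B)) (n : ℕ)
    (s : Fin k → A × B) : 0 ≤ emissionEntropy Q n s :=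
  Finset.sum_nonneg fun y _ => Real.negMulLog_nonneg (emissionProb_nonneg hQ n s y) <| by
    rw [← sum_emissionProb hQ n s]
    exact Finset.single_le_sum (fun y _ => emissionProb_nonneg hQ n s y) (Finset.mem_univ y)

lemma emissionEntropy_le (hQ : ∀ s, Q s ∈ stdSimplex ℝ (A × B)) (n : ℕ)
    (s : Fin k → A × B) : emissionEntropy Q n s ≤ n * Real.log (Fintype.card B) := by
  have := sum_negMulLog_le_log_card _ (emissionProb_nonneg hQ n s) (sum_emissionProb hQ n s)
  simpa [emissionEntropy] using this

variable [MeasurableSpace Ω] {μ : Measure Ω}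
  [MeasurableSpace A] [MeasurableSingletonClass A] [MeasurableSpace B] [MeasurableSingletonClass B]
  {X : ℤ → Ω → A} {Y : ℤ → Ω → B}

lemma IsMarkovChain.measureReal_block_emission [IsFiniteMeasure μ]
    (hX : ∀ n : ℤ, 1 - (k : ℤ) ≤ n → Measurable (X n))
    (hY : ∀ n : ℤ, 1 - (k : ℤ) ≤ n → Measurable (Y n))
    (hXY : IsMarkovChain μ (fun n ω => (X n ω, Y n ω)) k Q) (n m : ℕ)
    (s : Fin k → A × B) (y : Fin n → B) :
    μ.real {ω | block (fun n ω => (X n ω, Y n ω)) ((m : ℤ) + 1 - k) k ω = s ∧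
        block Y ((m : ℤ) + 1) n ω = y} =
      μ.real {ω | block (fun n ω => (X n ω, Y n ω)) ((m : ℤ) + 1 - k) k ω = s} *
        emissionProb Q n s y :=
  measureReal_kernel_of_ker (measurable_block (fun i hi => (hX i hi).prodMk (hY i hi)) _)
    (fun (w : Fin (m + k) → A × B) (j : Fin k) => w (Fin.natAdd m j)) id (emissionProb Q n)
    (hXY.measureReal_emission hX n m)
    (fun ω ω' h => by
      rw [block_eq_block_iff] at h ⊢
      exact fun t h1 h2 => h t (by omega) (by push_cast; omega))
    (fun ω => by rw [block_natAdd]; rfl) s y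

/-- The entropy of the outputs, up to a bounded error, is the average of the entropies of the
laws of the outputs given the block at time `m`. -/
lemma IsMarkovChain.exists_entropy_block_bound [IsProbabilityMeasure μ]
    (hQ : ∀ s, Q s ∈ stdSimplex ℝ (A × B))
    (hX : ∀ n : ℤ, 1 - (k : ℤ) ≤ n → Measurable (X n))
    (hY : ∀ n : ℤ, 1 - (k : ℤ) ≤ n → Measurable (Y n))
    (hXY : IsMarkovChain μ (fun n ω => (X n ω, Y n ω)) k Q) (m : ℕ) :
    ∃ C, ∀ n, |entropy μ (block Y 1 (m + n)) -
      ∑ s, μ.real {ω | block (fun n ω => (X n ω, Y n ω)) ((m : ℤ) + 1 - k) k ω = s} *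
        emissionEntropy Q n s| ≤ C := by
  set V : Ω → Fin k → A × B := block (fun n ω => (X n ω, Y n ω)) ((m : ℤ) + 1 - k) k with hV
  have mV : Measurable V :=
    measurable_block (fun i hi => (hX i (by omega)).prodMk (hY i (by omega))) _
  -- The averaged sum is the entropy of the later outputs given `V`: conditioning on `V` costs at
  -- most its entropy, and adjoining the first `m` outputs adds at most theirs.
  refine ⟨entropy μ (block Y 1 m) + entropy μ V, fun n => ?_⟩
  have mY : ∀ j : ℕ, ∀ l, Measurable (block Y ((j : ℤ) + 1) l) := fun j l =>
    measurable_block (fun i hi => hY i (by omega)) _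
  have m1 : ∀ l, Measurable (block Y 1 l) := by simpa using mY 0
  have chain := entropy_prod_eq_of_kernel (μ := μ) mV (Z := block Y ((m : ℤ) + 1) n) id
    (emissionProb Q n) (hXY.measureReal_block_emission hX hY n m)
    fun w _ => sum_emissionProb hQ n w
  have h1 := entropy_prod_le (μ := μ) mV (mY m n)
  have h2 : entropy μ (block Y ((m : ℤ) + 1) n) ≤
      entropy μ (fun ω => (V ω, block Y ((m : ℤ) + 1) n ω)) :=
    entropy_le_of_ker (mV.prodMk (mY m n)) fun ω ω' h => (Prod.ext_iff.1 h).2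
  have h3 : entropy μ (block Y ((m : ℤ) + 1) n) ≤ entropy μ (block Y 1 (m + n)) :=
    entropy_le_of_ker (m1 _) fun ω ω' h => by
      rw [block_eq_block_iff] at h ⊢
      exact fun t h1 h2 => h t (by omega) (by push_cast; omega)
  have h4 : entropy μ (block Y 1 (m + n)) ≤
      entropy μ (block Y 1 m) + entropy μ (block Y ((m : ℤ) + 1) n) :=
    entropy_le_add_of_ker (m1 m) (mY m n) fun ω ω' h h' => by
      rw [block_eq_block_iff] at h h' ⊢
      intro t h1 h2
      by_cases ht : t < 1 + m
      · exact h t h1 ht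
      · exact h' t (by omega) (by push_cast at h2; omega)
  have h5 := entropy_nonneg (μ := μ) V
  have h6 := entropy_nonneg (μ := μ) (block Y 1 m)
  simp only [id] at chain
  change _ = _ + ∑ s, μ.real {ω | V ω = s} * emissionEntropy Q n s at chain
  rw [abs_le]
  constructor <;> linarith

end Emission

/-! ### Entropy rates and limits of conditional entropies -/

section Rates

/-- Sequences at sublinear distance have the same linear growth rate. -/
lemma tendsto_div_of_abs_sub_le {u v : ℕ → ℝ} {h : ℝ}
    (huv : ∀ ε > 0, ∃ (C : ℝ) (M : ℕ), ∀ n ≥ M, |u n - v n| ≤ C + ε * n)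
    (hv : Tendsto (fun n : ℕ => 1 / (n : ℝ) * v n) atTop (𝓝 h)) :
    Tendsto (fun n : ℕ => 1 / (n : ℝ) * u n) atTop (𝓝 h) := by
  have key : Tendsto (fun n : ℕ => 1 / (n : ℝ) * (u n - v n)) atTop (𝓝 0) := by
    rw [Metric.tendsto_atTop]
    intro ε hε
    obtain ⟨C, M, hM⟩ := huv (ε / 2) (half_pos hε)
    obtain ⟨K, hK⟩ := exists_nat_gt (C / (ε / 2))
    refine ⟨max M (K + 1), fun n hn => ?_⟩
    have hn1 : M ≤ n := le_of_max_le_left hn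
    have hn2 : (K : ℝ) + 1 ≤ n := by exact_mod_cast le_of_max_le_right hn
    have hn0 : (0 : ℝ) < n := by linarith [(Nat.cast_nonneg K : (0 : ℝ) ≤ K)]
    have h1 : C < n * (ε / 2) := (div_lt_iff₀ (half_pos hε)).1 (by linarith)
    rw [Real.dist_eq, sub_zero, abs_mul, abs_of_nonneg (by positivity), one_div,
      inv_mul_lt_iff₀ hn0]
    linarith [hM n hn1]
  simpa [mul_sub] using key.add hv

variable {Ω Ω' A B : Type*} [Fintype A] [MeasurableSpace A] [MeasurableSingletonClass A]
  [Fintype B] [MeasurableSpace B] [MeasurableSingletonClass B]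
  [MeasurableSpace Ω] [MeasurableSpace Ω'] {μ : Measure Ω} [IsProbabilityMeasure μ]
  {μ' : Measure Ω'} [IsProbabilityMeasure μ'] {k : ℕ} {Q : (Fin k → A × B) → A × B → ℝ}
  {X : ℤ → Ω → A} {Y : ℤ → Ω → B} {Xs : ℤ → Ω' → A} {Ys : ℤ → Ω' → B}

/-- Block entropies of a stationary process are subadditive, so Fekete's lemma applies. -/
lemma IsStationary.exists_hasEntropyRate (hXs : ∀ n : ℤ, Measurable (Xs n))
    (hYs : ∀ n : ℤ, Measurable (Ys n)) (hstat : IsStationary μ' (fun n ω => (Xs n ω, Ys n ω))) :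
    ∃ h, HasEntropyRate μ' Ys h := by
  have mZ : ∀ i m, Measurable (block (fun n ω => (Xs n ω, Ys n ω)) i m) := fun i m =>
    measurable_block (fun n _ => (hXs n).prodMk (hYs n)) m
  have mY : ∀ i m, Measurable (block Ys i m) := fun i m => measurable_block (fun n _ => hYs n) m
  have shift : ∀ i j m, entropy μ' (block Ys i m) = entropy μ' (block Ys j m) := fun i j m =>
    entropy_comp_congr (mZ i m) (mZ j m) (hstat i j m) fun w l => (w l).2
  have hsub : Subadditive fun n => entropy μ' (block Ys 1 n) := by
    intro m n
    beta_reduce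
    rw [shift 1 (1 + m) n]
    refine entropy_le_add_of_ker (mY _ _) (mY _ _) fun ω ω' h h' => ?_
    rw [block_eq_block_iff] at h h' ⊢
    intro t h1 h2
    by_cases ht : t < 1 + m
    · exact h t h1 ht
    · exact h' t (by omega) (by push_cast at h2; omega)
  refine ⟨hsub.lim, ?_⟩
  have := hsub.tendsto_lim ⟨0, by
    rintro _ ⟨n, rfl⟩
    exact div_nonneg (entropy_nonneg _) n.cast_nonneg⟩
  refine this.congr fun n => ?_
  rw [one_div, div_eq_inv_mul]

/-- The entropy rate of the output does not depend on the initial law. -/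
lemma IsMarkovChain.hasEntropyRate (hQ : ∀ s, Q s ∈ stdSimplex ℝ (A × B))
    (hirr : IsIrreducible Q) (haper : IsAperiodic Q)
    (hX : ∀ n : ℤ, 1 - (k : ℤ) ≤ n → Measurable (X n))
    (hY : ∀ n : ℤ, 1 - (k : ℤ) ≤ n → Measurable (Y n))
    (hXY : IsMarkovChain μ (fun n ω => (X n ω, Y n ω)) k Q)
    (hXs : ∀ n : ℤ, Measurable (Xs n)) (hYs : ∀ n : ℤ, Measurable (Ys n))
    (hs : IsMarkovChain μ' (fun n ω => (Xs n ω, Ys n ω)) k Q)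
    (hstat : IsStationary μ' (fun n ω => (Xs n ω, Ys n ω))) {h : ℝ}
    (hh : HasEntropyRate μ' Ys h) : HasEntropyRate μ Y h := by
  refine tendsto_div_of_abs_sub_le (fun ε hε => ?_) hh
  set L := Real.log (Fintype.card B) with hL
  have hL0 : 0 ≤ L := Real.log_natCast_nonneg _
  set ν : ℕ → (Fin k → A × B) → ℝ := fun m s =>
    μ.real {ω | block (fun n ω => (X n ω, Y n ω)) ((m : ℤ) + 1 - k) k ω = s} with hν
  set π : (Fin k → A × B) → ℝ := fun s =>
    μ'.real {ω | block (fun n ω => (Xs n ω, Ys n ω)) 0 k ω = s} with hπ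
  have ht : Tendsto (fun m => (∑ s, |ν m s - π s|) * L) atTop (𝓝 0) := by
    have h1 : ∀ s, Tendsto (fun m => |ν m s - π s|) atTop (𝓝 0) := fun s => by
      have : Tendsto (fun m => ν m s) atTop (𝓝 (π s)) :=
        hXY.tendsto_law hQ hirr haper (fun n hn => (hX n hn).prodMk (hY n hn)) hs
          (fun n => (hXs n).prodMk (hYs n)) hstat 0 s
      simpa only [sub_self, abs_zero] using (this.sub_const (π s)).abs
    simpa using (tendsto_finsetSum Finset.univ fun s _ => h1 s).mul_const L
  -- `m` is fixed before `n` grows, so the constants below may depend on it.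
  obtain ⟨m, hm⟩ := (ht.eventually_lt_const hε).exists
  obtain ⟨C₁, h₁⟩ := hXY.exists_entropy_block_bound hQ hX hY m
  obtain ⟨C₂, h₂⟩ := hs.exists_entropy_block_bound hQ (fun n _ => hXs n) (fun n _ => hYs n) m
  refine ⟨C₁ + C₂, m, fun N hN => ?_⟩
  obtain ⟨n, rfl⟩ := Nat.exists_eq_add_of_le hN
  have e₁ := h₁ n
  have e₂ := h₂ n
  simp only [hstat ((m : ℤ) + 1 - k) 0] at e₂
  have e₃ : |∑ s, ν m s * emissionEntropy Q n s - ∑ s, π s * emissionEntropy Q n s| ≤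
      ε * (m + n : ℕ) := by
    rw [← Finset.sum_sub_distrib]
    calc _ ≤ ∑ s, |ν m s * emissionEntropy Q n s - π s * emissionEntropy Q n s| :=
          Finset.abs_sum_le_sum_abs _ _
      _ ≤ ∑ s, |ν m s - π s| * (n * L) := by
          refine Finset.sum_le_sum fun s _ => ?_
          rw [← sub_mul, abs_mul, abs_of_nonneg (emissionEntropy_nonneg hQ n s)]
          exact mul_le_mul_of_nonneg_left (emissionEntropy_le hQ n s) (abs_nonneg _)
      _ = (∑ s, |ν m s - π s|) * L * n := by rw [← Finset.sum_mul]; ring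
      _ ≤ ε * n := mul_le_mul_of_nonneg_right hm.le n.cast_nonneg
      _ ≤ ε * (m + n : ℕ) := by
          push_cast
          nlinarith [(Nat.cast_nonneg m : (0 : ℝ) ≤ m)]
  rw [abs_le] at e₁ e₂ e₃ ⊢
  constructor <;> linarith [e₁.1, e₁.2, e₂.1, e₂.2, e₃.1, e₃.2]

/-- The causally conditioned entropies converge. -/
lemma IsMarkovChain.tendsto_condEntropy (hQ : ∀ s, Q s ∈ stdSimplex ℝ (A × B))
    (hirr : IsIrreducible Q) (haper : IsAperiodic Q)
    (hX : ∀ n : ℤ, 1 - (k : ℤ) ≤ n → Measurable (X n))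
    (hY : ∀ n : ℤ, 1 - (k : ℤ) ≤ n → Measurable (Y n))
    (hXY : IsMarkovChain μ (fun n ω => (X n ω, Y n ω)) k Q)
    (hXs : ∀ n : ℤ, Measurable (Xs n)) (hYs : ∀ n : ℤ, Measurable (Ys n))
    (hs : IsMarkovChain μ' (fun n ω => (Xs n ω, Ys n ω)) k Q)
    (hstat : IsStationary μ' (fun n ω => (Xs n ω, Ys n ω))) :
    Tendsto (fun i : ℕ => condEntropy μ (Y ((i : ℤ) + 1))
        (fun ω => (block Y 1 i ω, block X 1 (i + 1) ω))) atTop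
      (𝓝 (condEntropy μ' (Ys 0)
        (fun ω => (block Xs (-(k : ℤ)) (k + 1) ω, block Ys (-(k : ℤ)) k ω)))) := by
  have mZ : ∀ n : ℤ, 1 - (k : ℤ) ≤ n → Measurable fun ω => (X n ω, Y n ω) :=
    fun n hn => (hX n hn).prodMk (hY n hn)
  have mZs : ∀ n : ℤ, Measurable fun ω => (Xs n ω, Ys n ω) := fun n => (hXs n).prodMk (hYs n)
  -- `G s` is the entropy of the second component given the first under the law `Q s`.
  set G : (Fin k → A × B) → ℝ := fun s => ∑ z, Real.negMulLog (Q s z) -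
        ∑ a, Real.negMulLog (∑ b, Q s (a, b)) with hG
  have e' : condEntropy μ' (Ys 0)
        (fun ω => (block Xs (-(k : ℤ)) (k + 1) ω, block Ys (-(k : ℤ)) k ω)) =
      ∑ s, μ'.real {ω | block (fun n ω => (Xs n ω, Ys n ω)) (-(k : ℤ)) k ω = s} * G s := by
    have h := entropy_prod_sub_eq_of_kernel (μ := μ')
      (measurable_block (i := -(k : ℤ)) (fun n _ => mZs n) k) (X := Xs 0) (hYs 0) id Q
      (fun s => (hQ s).2) (fun s z => by
        simpa using hs.measureReal_block_of_stationary mZs hstat (-(k : ℤ)) s z)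
    rw [hG]
    refine Eq.trans ?_ h
    unfold condEntropy
    congr 1
    · refine entropy_congr_of_ker fun ω ω' => ?_
      simp only [Prod.mk.injEq, block_eq_block_iff]
      constructor
      · rintro ⟨h0, h1, h2⟩
        exact ⟨fun t ht ht' => ⟨h1 t ht (by push_cast; omega), h2 t ht ht'⟩,
          h1 0 (by omega) (by push_cast; omega), h0⟩
      · rintro ⟨h1, h2, h3⟩
        refine ⟨h3, fun t ht ht' => ?_, fun t ht ht' => (h1 t ht ht').2⟩
        rcases eq_or_ne t 0 with rfl | h0
        · exact h2
        · exact (h1 t ht (by push_cast at ht'; omega)).1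
    · refine entropy_congr_of_ker fun ω ω' => ?_
      simp only [Prod.mk.injEq, block_eq_block_iff]
      constructor
      · rintro ⟨h1, h2⟩
        exact ⟨fun t ht ht' => ⟨h1 t ht (by push_cast; omega), h2 t ht ht'⟩,
          h1 0 (by omega) (by push_cast; omega)⟩
      · rintro ⟨h1, h2⟩
        refine ⟨fun t ht ht' => ?_, fun t ht ht' => (h1 t ht ht').2⟩
        rcases eq_or_ne t 0 with rfl | h0
        · exact h2
        · exact (h1 t ht (by push_cast at ht'; omega)).1
  -- For `k ≤ i` the window from `1` to `i` contains the last `k` pairs, which `f` reads off.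
  have e : ∀ i : ℕ, k ≤ i → condEntropy μ (Y ((i : ℤ) + 1))
        (fun ω => (block Y 1 i ω, block X 1 (i + 1) ω)) =
      ∑ s, μ.real {ω | block (fun n ω => (X n ω, Y n ω)) ((i : ℤ) + 1 - k) k ω = s} * G s := by
    intro i hi
    set f : (Fin i → A × B) → Fin k → A × B := fun w j => w ⟨i - k + j, by omega⟩ with hf
    have hfb : ∀ ω, f (block (fun n ω => (X n ω, Y n ω)) 1 i ω) =
        block (fun n ω => (X n ω, Y n ω)) ((i : ℤ) + 1 - k) k ω := by
      intro ω
      ext1 j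
      simp only [hf, block]
      rw [show (1 : ℤ) + ((i - k + (j : ℕ) : ℕ) : ℤ) = (i : ℤ) + 1 - k + ((j : ℕ) : ℤ) by
        omega]
    have h := entropy_prod_sub_eq_of_kernel (μ := μ)
      (measurable_block (i := 1) (fun n hn => mZ n (by omega)) i) (X := X ((i : ℤ) + 1))
      (hY ((i : ℤ) + 1) (by omega)) f Q (fun s => (hQ s).2)
      (hXY.measureReal_of_ker mZ i f (fun ω ω' h => by
        rw [block_eq_block_iff] at h ⊢
        exact fun t h1 h2 => h t (by omega) (by push_cast; omega)) hfb)
    simp only [hfb] at h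
    rw [hG]
    refine Eq.trans ?_ h
    unfold condEntropy
    congr 1
    · refine entropy_congr_of_ker fun ω ω' => ?_
      simp only [Prod.mk.injEq, block_eq_block_iff]
      constructor
      · rintro ⟨h0, h1, h2⟩
        exact ⟨fun t ht ht' => ⟨h2 t ht (by push_cast; omega), h1 t ht ht'⟩,
          h2 _ (by omega) (by push_cast; omega), h0⟩
      · rintro ⟨h1, h2, h3⟩
        refine ⟨h3, fun t ht ht' => (h1 t ht ht').2, fun t ht ht' => ?_⟩
        rcases eq_or_ne t ((i : ℤ) + 1) with rfl | h0
        · exact h2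
        · exact (h1 t ht (by push_cast at ht'; omega)).1
    · refine entropy_congr_of_ker fun ω ω' => ?_
      simp only [Prod.mk.injEq, block_eq_block_iff]
      constructor
      · rintro ⟨h1, h2⟩
        exact ⟨fun t ht ht' => ⟨h2 t ht (by push_cast; omega), h1 t ht ht'⟩,
          h2 _ (by omega) (by push_cast; omega)⟩
      · rintro ⟨h1, h2⟩
        refine ⟨fun t ht ht' => (h1 t ht ht').2, fun t ht ht' => ?_⟩
        rcases eq_or_ne t ((i : ℤ) + 1) with rfl | h0
        · exact h2
        · exact (h1 t ht (by push_cast at ht'; omega)).1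
  rw [e']
  refine (tendsto_finsetSum _ fun s _ => ?_).congr'
    (eventually_atTop.2 ⟨k, fun i hi => (e i hi).symm⟩)
  exact (hXY.tendsto_law hQ hirr haper mZ hs mZs hstat (-(k : ℤ)) s).mul_const _

/-- If the output is Markov, its entropy rate is the conditional entropy given `k` symbols. -/
lemma IsMarkovOfOrder.hasEntropyRate (hQ : ∀ s, Q s ∈ stdSimplex ℝ (A × B))
    (hirr : IsIrreducible Q) (haper : IsAperiodic Q)
    (hX : ∀ n : ℤ, 1 - (k : ℤ) ≤ n → Measurable (X n))
    (hY : ∀ n : ℤ, 1 - (k : ℤ) ≤ n → Measurable (Y n))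
    (hXY : IsMarkovChain μ (fun n ω => (X n ω, Y n ω)) k Q)
    (hXs : ∀ n : ℤ, Measurable (Xs n)) (hYs : ∀ n : ℤ, Measurable (Ys n))
    (hs : IsMarkovChain μ' (fun n ω => (Xs n ω, Ys n ω)) k Q)
    (hstat : IsStationary μ' (fun n ω => (Xs n ω, Ys n ω))) (hM : IsMarkovOfOrder μ Y k) :
    HasEntropyRate μ Y (condEntropy μ' (Ys 0) (block Ys (-(k : ℤ)) k)) := by
  have mZ : ∀ n : ℤ, 1 - (k : ℤ) ≤ n → Measurable fun ω => (X n ω, Y n ω) :=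
    fun n hn => (hX n hn).prodMk (hY n hn)
  have mZs : ∀ n : ℤ, Measurable fun ω => (Xs n ω, Ys n ω) := fun n => (hXs n).prodMk (hYs n)
  -- The window starts at `1 - k` because the Markov property conditions on the whole past from
  -- there; the extra `k` symbols cost at most `a 0`.
  set a : ℕ → ℝ := fun n => entropy μ (block Y (1 - (k : ℤ)) (n + k)) with ha
  have inc : ∀ n : ℕ, a (n + 1) - a n =
      entropy μ (fun ω => (block Y ((n : ℤ) + 1 - k) k ω, Y ((n : ℤ) + 1) ω)) -
        entropy μ (block Y ((n : ℤ) + 1 - k) k) := by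
    intro n
    set W : Ω → Fin k → B := block Y ((n : ℤ) + 1 - k) k with hW
    have mW : Measurable W := measurable_block (fun i hi => hY i (by omega)) k
    have mP : Measurable (block Y (1 - (k : ℤ)) (n + k)) := measurable_block hY _
    -- The conditional law by division. It sums to one only at values of positive probability, which
    -- is all that the chain rule needs.
    set q : (Fin k → B) → B → ℝ := fun s z =>
      μ.real {ω | W ω = s ∧ Y ((n : ℤ) + 1) ω = z} / μ.real {ω | W ω = s} with hq
    have q1 : ∀ s, μ.real {ω | W ω = s} ≠ 0 → ∑ z, q s z = 1 := by
      intro s hs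
      rw [← Finset.sum_div, div_eq_one_iff_eq hs,
        measureReal_eq_sum_fiber (hY ((n : ℤ) + 1) (by omega)) {ω | W ω = s}]
      rfl
    have hsubset : ∀ w : Fin (n + k) → B, μ.real {ω | block Y (1 - (k : ℤ)) (n + k) ω = w} ≤
        μ.real {ω | W ω = fun j => w (Fin.natAdd n j)} := fun w =>
      measureReal_mono fun ω hω => by
        have hω' : block Y (1 - (k : ℤ)) (n + k) ω = w := hω
        subst hω'
        exact (block_natAdd Y n ω).symm
    have zero : ∀ w : Fin (n + k) → B, μ.real {ω | W ω = fun j => w (Fin.natAdd n j)} = 0 →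
        μ.real {ω | block Y (1 - (k : ℤ)) (n + k) ω = w} = 0 := fun w h0 =>
      le_antisymm (h0 ▸ hsubset w) measureReal_nonneg
    have c1 := entropy_prod_eq_of_kernel (μ := μ) mW (Z := Y ((n : ℤ) + 1)) id q
      (fun s z => by
        by_cases h0 : μ.real {ω | W ω = s} = 0
        · rw [h0, zero_mul]
          exact le_antisymm (h0 ▸ measureReal_mono fun ω h => h.1) measureReal_nonneg
        · exact (mul_div_cancel₀ _ h0).symm) q1
    have c2 := entropy_prod_eq_of_kernel (μ := μ) mP (Z := Y ((n : ℤ) + 1))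
      (fun (w : Fin (n + k) → B) (j : Fin k) => w (Fin.natAdd n j)) q
      (fun w z => by
        by_cases h0 : μ.real {ω | W ω = fun j => w (Fin.natAdd n j)} = 0
        · rw [zero w h0, zero_mul]
          exact le_antisymm (zero w h0 ▸ measureReal_mono fun ω h => h.1) measureReal_nonneg
        · rw [hq, ← mul_div_assoc, eq_div_iff h0]
          exact hM n w z)
      (fun w hw => q1 _ fun h0 => hw (zero w h0))
    simp only [block_natAdd] at c2
    have c3 : a (n + 1) =
        entropy μ (fun ω => (block Y (1 - (k : ℤ)) (n + k) ω, Y ((n : ℤ) + 1) ω)) := by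
      refine entropy_congr_of_ker fun ω ω' => ?_
      simp only [Prod.mk.injEq, block_eq_block_iff]
      constructor
      · intro h
        exact ⟨fun t ht ht' => h t ht (by push_cast at ht' ⊢; omega),
          h _ (by omega) (by push_cast; omega)⟩
      · rintro ⟨h1, h2⟩ t ht ht'
        rcases eq_or_ne t ((n : ℤ) + 1) with rfl | h0
        · exact h2
        · exact h1 t ht (by push_cast at ht' ⊢; omega)
    rw [c3, c2, c1]
    simp only [ha, id]
    ring
  -- The pair chain, unlike `Y`, has a fixed kernel: this joint law is the law of the block times
  -- `Q`. Projecting to outputs afterwards gives both entropies in `inc`.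
  have conv : ∀ v : (Fin k → A × B) × (A × B),
      Tendsto (fun n : ℕ => μ.real {ω | (block (fun n ω => (X n ω, Y n ω)) ((n : ℤ) + 1 - k) k ω,
        (X ((n : ℤ) + 1) ω, Y ((n : ℤ) + 1) ω)) = v}) atTop
      (𝓝 (μ'.real {ω | (block (fun n ω => (Xs n ω, Ys n ω)) (-(k : ℤ)) k ω,
        (Xs 0 ω, Ys 0 ω)) = v})) := by
    rintro ⟨s, z⟩
    have h1 := hs.measureReal_block_of_stationary mZs hstat (-(k : ℤ)) s z
    have h2 := fun n => hXY.measureReal_block mZ n s z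
    simp only [neg_add_cancel] at h1
    simp only [Prod.mk.injEq (_ : Fin k → A × B), h1, h2]
    exact (hXY.tendsto_law hQ hirr haper mZ hs mZs hstat (-(k : ℤ)) s).mul_const _
  have mV : ∀ n : ℕ, Measurable fun ω => (block (fun n ω => (X n ω, Y n ω)) ((n : ℤ) + 1 - k) k ω,
        (X ((n : ℤ) + 1) ω, Y ((n : ℤ) + 1) ω)) := fun n =>
    (measurable_block (fun i hi => mZ i (by omega)) k).prodMk (mZ _ (by omega))
  have mVs : Measurable fun ω => (block (fun n ω => (Xs n ω, Ys n ω)) (-(k : ℤ)) k ω,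
        (Xs 0 ω, Ys 0 ω)) := (measurable_block (fun i _ => mZs i) k).prodMk (mZs _)
  have t1 := tendsto_entropy_comp (Eventually.of_forall mV) mVs conv
    fun x => ((fun j => (x.1 j).2 : Fin k → B), x.2.2)
  have t2 := tendsto_entropy_comp (Eventually.of_forall mV) mVs conv
    fun x => (fun j => (x.1 j).2 : Fin k → B)
  have tinc : Tendsto (fun n => a (n + 1) - a n) atTop
      (𝓝 (condEntropy μ' (Ys 0) (block Ys (-(k : ℤ)) k))) := by
    simp only [inc]
    have e : condEntropy μ' (Ys 0) (block Ys (-(k : ℤ)) k) =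
        entropy μ' (fun ω => (block Ys (-(k : ℤ)) k ω, Ys 0 ω)) -
          entropy μ' (block Ys (-(k : ℤ)) k) := by
      unfold condEntropy
      congr 1
      exact entropy_congr_of_ker fun ω ω' => by simp only [Prod.mk.injEq, and_comm]
    rw [e]
    exact t1.sub t2
  have hces := tinc.cesaro
  simp only [Finset.sum_range_sub] at hces
  refine tendsto_div_of_abs_sub_le (v := fun n => a n - a 0) (fun ε hε => ?_)
    (by simpa only [one_div] using hces)
  refine ⟨a 0, 0, fun n _ => ?_⟩
  have b1 : entropy μ (block Y 1 n) ≤ a n :=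
    entropy_le_of_ker (measurable_block hY _) fun ω ω' h => by
      rw [block_eq_block_iff] at h ⊢
      exact fun t h1 h2 => h t (by omega) (by push_cast; omega)
  have b2 : a n ≤ a 0 + entropy μ (block Y 1 n) :=
    entropy_le_add_of_ker (measurable_block hY _)
      (measurable_block (fun i hi => hY i (by omega)) n) fun ω ω' h h' => by
      rw [block_eq_block_iff] at h h' ⊢
      intro t h1 h2
      by_cases ht : t < 1
      · exact h t h1 (by push_cast; omega)
      · exact h' t (by omega) (by push_cast at h2; omega)
  have b3 : 0 ≤ ε * n := by positivity
  rw [abs_le]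
  constructor <;> linarith

end Rates

end DirectedInfo

/-! ### The theorem -/

theorem proposition3 {A B Ω Ω' : Type*}
    [Fintype A] [MeasurableSpace A] [MeasurableSingletonClass A]
    [Fintype B] [MeasurableSpace B] [MeasurableSingletonClass B]
    [MeasurableSpace Ω] [MeasurableSpace Ω']
    (μ : Measure Ω) [IsProbabilityMeasure μ] (μ' : Measure Ω') [IsProbabilityMeasure μ']
    (k : ℕ) (hk : 1 ≤ k)
    -- the transition probabilities of the pair chain
    (Q : (Fin k → A × B) → A × B → ℝ) (hQ : ∀ s, Q s ∈ stdSimplex ℝ (A × B))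
    (hirr : IsIrreducible Q) (haper : IsAperiodic Q)
    -- the chain `{(X_n, Y_n) ; n ≥ 1 - k}`, with an arbitrary initial distribution
    (X : ℤ → Ω → A) (Y : ℤ → Ω → B)
    (hX : ∀ n : ℤ, 1 - (k : ℤ) ≤ n → Measurable (X n))
    (hY : ∀ n : ℤ, 1 - (k : ℤ) ≤ n → Measurable (Y n))
    (hXY : IsMarkovChain μ (fun n ω => (X n ω, Y n ω)) k Q)
    -- its stationary version `{(Xs_n, Ys_n) ; n ∈ ℤ}`
    (Xs : ℤ → Ω' → A) (Ys : ℤ → Ω' → B)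
    (hXs : ∀ n : ℤ, Measurable (Xs n)) (hYs : ∀ n : ℤ, Measurable (Ys n))
    (hs : IsMarkovChain μ' (fun n ω => (Xs n ω, Ys n ω)) k Q)
    (hstat : IsStationary μ' (fun n ω => (Xs n ω, Ys n ω))) :
    ∃ h : ℝ,
      -- (i)
      (HasEntropyRate μ Y h ∧ HasEntropyRate μ' Ys h) ∧
      -- (ii)
      HasDirectedInfoRate μ X Y
        (h - condEntropy μ' (Ys 0)
          (fun ω => (block Xs (-(k : ℤ)) (k + 1) ω, block Ys (-(k : ℤ)) k ω))) ∧
      -- (iii)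
      (IsMarkovOfOrder μ Y k →
        HasDirectedInfoRate μ X Y
          (condMutualInfo μ' (Ys 0) (block Xs (-(k : ℤ)) (k + 1)) (block Ys (-(k : ℤ)) k))) := by
  obtain ⟨h, hh⟩ := hstat.exists_hasEntropyRate hXs hYs
  have hrate := hXY.hasEntropyRate hQ hirr haper hX hY hXs hYs hs hstat hh
  have hdir : HasDirectedInfoRate μ X Y
      (h - condEntropy μ' (Ys 0)
        (fun ω => (block Xs (-(k : ℤ)) (k + 1) ω, block Ys (-(k : ℤ)) k ω))) := by
    have hces := (hXY.tendsto_condEntropy hQ hirr haper hX hY hXs hYs hs hstat).cesaro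
    simpa only [HasDirectedInfoRate, directedInfo, mul_sub, one_div] using
      hrate.sub (by simpa only [one_div] using hces)
  refine ⟨h, ⟨hrate, hh⟩, hdir, fun hM => ?_⟩
  -- The Markov property is assumed for `Y` only; uniqueness of the limit carries the value over to
  -- the common rate `h`.
  have hlim : h = condEntropy μ' (Ys 0) (block Ys (-(k : ℤ)) k) := tendsto_nhds_unique hrate
    (hM.hasEntropyRate hQ hirr haper hX hY hXY hXs hYs hs hstat)
  have e : condMutualInfo μ' (Ys 0) (block Xs (-(k : ℤ)) (k + 1)) (block Ys (-(k : ℤ)) k) =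
      h - condEntropy μ' (Ys 0)
        (fun ω => (block Xs (-(k : ℤ)) (k + 1) ω, block Ys (-(k : ℤ)) k ω)) := by
    have e1 : entropy μ' (fun ω => ((Ys 0 ω, block Xs (-(k : ℤ)) (k + 1) ω),
          block Ys (-(k : ℤ)) k ω)) =
        entropy μ' (fun ω => (Ys 0 ω, (block Xs (-(k : ℤ)) (k + 1) ω,
          block Ys (-(k : ℤ)) k ω))) :=
      entropy_congr_of_ker fun ω ω' => by simp only [Prod.mk.injEq, and_assoc]
    rw [hlim]
    simp only [condMutualInfo, condEntropy, e1]
    ring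
  rw [e]
  exact hdir
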